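/- Let $X$ be an infinite-dimensional complex Banach space and let $T$ be a bounded linear operator on $X$. Write $N(S)$ and $R(S)$ for the null space and the range of a bounded operator $S$ on $X$, $\sigma(T)$ for the spectrum, $\sigma_a(T)=\{\lambda\in\mathbb{C}: T-\lambda I \text{ is not bounded below}\}$ for the approximate point spectrum, and $\operatorname{iso}A$ for the set of isolated points of $A\subset\mathbb{C}$. Call $S$ Fredholm if $\dim N(S)<\infty$ and $\operatorname{codim}R(S)<\infty$ (then $R(S)$ is closed), and Weyl if it is Fredholm of index $\dim N(S)-\operatorname{codim}R(S)=0$; let $\sigma_W(T)=\{\lambda\in\mathbb{C}: T-\lambda I\text{ is not Weyl}\}$. The ascent of $S$ is $a(S)=\inf\{n\ge 0: N(S^n)=N(S^{n+1})\}$ and the descent is $\delta(S)=\inf\{n\ge 0: R(S^n)=R(S^{n+1})\}$, with $\inf\emptyset=\infty$. Define - $\sigma_p(T)$: the eigenvalues of $T$; $\sigma_p^0(T)$: the eigenvalues $\lambda$ with $\dim N(T-\lambda I)<\infty$; - $E(T)=\operatorname{iso}\sigma(T)\cap\sigma_p(T)$, $E^0(T)=\operatorname{iso}\sigma(T)\cap\sigma_p^0(T)$;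 - $E_a(T)=\operatorname{iso}\sigma_a(T)\cap\sigma_p(T)$, $E_a^0(T)=\operatorname{iso}\sigma_a(T)\cap\sigma_p^0(T)$; - $\Pi(T)$ (poles): the $\lambda\in\sigma(T)$ with $a(T-\lambda I)<\infty$ and $\delta(T-\lambda I)<\infty$; $\Pi^0(T)$: the $\lambda\in\Pi(T)$ with $\dim N(T-\lambda I)<\infty$; - $\Pi_a(T)$ (left poles): the $\lambda\in\sigma_a(T)$ such that $a(T-\lambda I)<\infty$ and $R\big((T-\lambda I)^{a(T-\lambda I)+1}\big)$ is closed; $\Pi_a^0(T)$: the $\lambda\in\Pi_a(T)$ with $\dim N(T-\lambda I)<\infty$. The operator $T$ has property $(Z_{E_a})$ if $\sigma(T)\setminus\sigma_W(T)=E_a(T)$. **Lemma.** If $T$ has property $(Z_{E_a})$, then $$E_a(T)=E_a^0(T)=\Pi_a^0(T)=\Pi_a(T)=\Pi^0(T)=\Pi(T)=E^0(T)=E(T).$$ -/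

import Mathlib

open Topology Filter

namespace WeylType

noncomputable section

/-- The isolated points of a set `A` of complex numbers: the points of `A` that are not
accumulation points of `A`. -/
def iso (A : Set ℂ) : Set ℂ := {z | z ∈ A ∧ ¬ AccPt z (𝓟 A)}

variable {X : Type*} [NormedAddCommGroup X] [NormedSpace ℂ X]

/-- The null space `N(S)`. -/
def nullSpace (S : X →L[ℂ] X) : Submodule ℂ X := LinearMap.ker (S : X →ₗ[ℂ] X)

/-- The range `R(S)`. -/
def rangeSpace (S : X →L[ℂ] X) : Submodule ℂ X := LinearMap.range (S : X →ₗ[ℂ] X)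

/-- The operator `T - lam I`. -/
def shift (T : X →L[ℂ] X) (lam : ℂ) : X →L[ℂ] X := T - lam • ContinuousLinearMap.id ℂ X

/-- Fredholm operators: the null space is finite-dimensional and the range has finite codimension.
(On a Banach space the range of such an operator is automatically closed, so that the codimension
of the range is the dimension of the null space of the dual operator.) -/
def IsFredholm (S : X →L[ℂ] X) : Prop :=
  FiniteDimensional ℂ (nullSpace S) ∧ FiniteDimensional ℂ (X ⧸ rangeSpace S)

/-- The index `dim N(S) - codim R(S)` (only meaningful for Fredholm operators). -/
def index (S : X →L[ℂ] X) : ℤ :=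
  (Module.finrank ℂ (nullSpace S) : ℤ) - (Module.finrank ℂ (X ⧸ rangeSpace S) : ℤ)

/-- Weyl operators: Fredholm operators of index `0`. -/
def IsWeyl (S : X →L[ℂ] X) : Prop := IsFredholm S ∧ index S = 0

/-- The Weyl spectrum. -/
def weylSpectrum (T : X →L[ℂ] X) : Set ℂ := {lam | ¬ IsWeyl (shift T lam)}

/-- Bounded below: `c ‖x‖ ≤ ‖S x‖` for all `x`, with some `c > 0`. -/
def IsBoundedBelow (S : X →L[ℂ] X) : Prop := ∃ c : ℝ, 0 < c ∧ ∀ x : X, c * ‖x‖ ≤ ‖S x‖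

/-- The approximate point spectrum `σ_a(T)`. -/
def approxPointSpectrum (T : X →L[ℂ] X) : Set ℂ := {lam | ¬ IsBoundedBelow (shift T lam)}

/-- The ascent, with value `⊤` if no power works. -/
def ascent (S : X →L[ℂ] X) : ℕ∞ :=
  sInf ((fun n : ℕ => (n : ℕ∞)) '' {n : ℕ | nullSpace (S ^ n) = nullSpace (S ^ (n + 1))})

/-- The descent, with value `⊤` if no power works. -/
def descent (S : X →L[ℂ] X) : ℕ∞ :=
  sInf ((fun n : ℕ => (n : ℕ∞)) '' {n : ℕ | rangeSpace (S ^ n) = rangeSpace (S ^ (n + 1))})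

/-- The eigenvalues `σ_p(T)`. -/
def eigenvalues (T : X →L[ℂ] X) : Set ℂ :=
  {lam | Module.End.HasEigenvalue (T : X →ₗ[ℂ] X) lam}

/-- The eigenvalues of finite multiplicity `σ_p^0(T)`. -/
def eigenvaluesFin (T : X →L[ℂ] X) : Set ℂ :=
  {lam | lam ∈ eigenvalues T ∧ FiniteDimensional ℂ (nullSpace (shift T lam))}

/-- `E(T)`: the isolated points of the spectrum that are eigenvalues. -/
def E (T : X →L[ℂ] X) : Set ℂ := iso (spectrum ℂ T) ∩ eigenvalues T

/-- `E^0(T)`: the isolated points of the spectrum that are eigenvalues of finite multiplicity. -/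
def E0 (T : X →L[ℂ] X) : Set ℂ := iso (spectrum ℂ T) ∩ eigenvaluesFin T

/-- `E_a(T)`: the isolated points of the approximate point spectrum that are eigenvalues. -/
def Ea (T : X →L[ℂ] X) : Set ℂ := iso (approxPointSpectrum T) ∩ eigenvalues T

/-- `E_a^0(T)`: the isolated points of the approximate point spectrum that are eigenvalues of
finite multiplicity. -/
def Ea0 (T : X →L[ℂ] X) : Set ℂ := iso (approxPointSpectrum T) ∩ eigenvaluesFin T

/-- `Π(T)`: the poles of the resolvent of `T`. -/
def poles (T : X →L[ℂ] X) : Set ℂ :=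
  {lam | lam ∈ spectrum ℂ T ∧ ascent (shift T lam) ≠ ⊤ ∧ descent (shift T lam) ≠ ⊤}

/-- `Π^0(T)`: the poles of finite rank. -/
def poles0 (T : X →L[ℂ] X) : Set ℂ :=
  {lam | lam ∈ poles T ∧ FiniteDimensional ℂ (nullSpace (shift T lam))}

/-- `Π_a(T)`: the left poles of `T`, that is, the `lam` in `σ_a(T)` for which `T - lam I` has
finite ascent `a` and the range of `(T - lam I) ^ (a + 1)` is closed. -/
def leftPoles (T : X →L[ℂ] X) : Set ℂ :=
  {lam | lam ∈ approxPointSpectrum T ∧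
    ∃ a : ℕ, ascent (shift T lam) = (a : ℕ∞) ∧
      IsClosed (rangeSpace (shift T lam ^ (a + 1)) : Set X)}

/-- `Π_a^0(T)`: the left poles of finite rank. -/
def leftPoles0 (T : X →L[ℂ] X) : Set ℂ :=
  {lam | lam ∈ leftPoles T ∧ FiniteDimensional ℂ (nullSpace (shift T lam))}

/-- Property `(Z_{E_a})`: the complement of the Weyl spectrum in the spectrum is `E_a(T)`. -/
def PropertyZEa (T : X →L[ℂ] X) : Prop := spectrum ℂ T \ weylSpectrum T = Ea T

end

end WeylType

/-! Two inclusions hold for every `T`: `poles T ⊆ E T ⊆ Ea T` and `leftPoles T ⊆ Ea T`. Both come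
from passing to the quotient by `N(S^p)`, with `S = T - aI` of ascent at most `p`: the induced
operator is invertible, respectively bounded below, and this persists for small shifts and lifts
back to `X` when the shift is nonzero. The property makes `S` Weyl at each point `a` of `Ea T`, and
`S - z` is injective for small `z ≠ 0`. Fredholmness then forces finite ascent
(`ascent_ne_top_of_isFredholm`), index zero turns this into finite descent
(`descent_ne_top_of_isWeyl`), and powers of `S` have closed range. So `a` is a pole and a left pole,
both of finite rank, and every inclusion closes up. -/

namespace WeylType

/-! ### Kernels and ranges of powers, ascent and descent -/

section NullSpaces

variable {X : Type*} [NormedAddCommGroup X] [NormedSpace ℂ X]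

theorem mem_nullSpace {S : X →L[ℂ] X} {x : X} : x ∈ nullSpace S ↔ S x = 0 := Iff.rfl

theorem mem_rangeSpace {S : X →L[ℂ] X} {x : X} : x ∈ rangeSpace S ↔ ∃ y, S y = x := Iff.rfl

theorem shift_apply (S : X →L[ℂ] X) (z : ℂ) (x : X) : shift S z x = S x - z • x := by
  simp [shift]

theorem shift_eq_sub_algebraMap (S : X →L[ℂ] X) (z : ℂ) :
    shift S z = S - algebraMap ℂ (X →L[ℂ] X) z := by
  ext x
  simp [shift_apply, Algebra.algebraMap_eq_smul_one]

theorem shift_shift (T : X →L[ℂ] X) (a b : ℂ) : shift (shift T a) b = shift T (a + b) := by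
  ext x
  simp only [shift_apply, add_smul]
  abel

theorem isClosed_nullSpace (S : X →L[ℂ] X) : IsClosed (nullSpace S : Set X) := S.isClosed_ker

theorem pow_apply_comm (S : X →L[ℂ] X) (n : ℕ) (x : X) : (S ^ n) (S x) = S ((S ^ n) x) := by
  rw [← mul_apply_eq_comp, ← mul_apply_eq_comp, ← pow_succ, ← pow_succ']

theorem pow_succ_apply (S : X →L[ℂ] X) (n : ℕ) (x : X) : (S ^ (n + 1)) x = (S ^ n) (S x) := by
  rw [pow_succ, mul_apply_eq_comp]

theorem nullSpace_pow_mono (S : X →L[ℂ] X) : Monotone fun n : ℕ => nullSpace (S ^ n) := by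
  refine monotone_nat_of_le_succ fun n x hx => ?_
  rw [mem_nullSpace] at hx ⊢
  rw [pow_succ_apply, pow_apply_comm, hx, map_zero]

theorem rangeSpace_pow_anti (S : X →L[ℂ] X) : Antitone fun n : ℕ => rangeSpace (S ^ n) := by
  refine antitone_nat_of_succ_le fun n x hx => ?_
  obtain ⟨y, rfl⟩ := hx
  exact ⟨S y, (pow_succ_apply S n y).symm⟩

theorem map_mem_nullSpace_pow (S : X →L[ℂ] X) (n : ℕ) {x : X} (hx : x ∈ nullSpace (S ^ n)) :
    S x ∈ nullSpace (S ^ n) := by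
  rw [mem_nullSpace] at hx ⊢
  rw [pow_apply_comm, hx, map_zero]

theorem nullSpace_pow_le_of_eq_succ {S : X →L[ℂ] X} {p : ℕ}
    (hp : nullSpace (S ^ p) = nullSpace (S ^ (p + 1))) (n : ℕ) :
    nullSpace (S ^ n) ≤ nullSpace (S ^ p) := by
  induction n with
  | zero => exact nullSpace_pow_mono S (Nat.zero_le p)
  | succ n ih =>
    intro x hx
    rw [hp, mem_nullSpace, pow_succ_apply]
    apply ih
    rwa [mem_nullSpace, ← pow_succ_apply]

theorem ascent_ne_top_iff {S : X →L[ℂ] X} :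
    ascent S ≠ ⊤ ↔ ∃ n : ℕ, nullSpace (S ^ n) = nullSpace (S ^ (n + 1)) := by
  simp [ascent, sInf_eq_top]

theorem descent_ne_top_iff {S : X →L[ℂ] X} :
    descent S ≠ ⊤ ↔ ∃ n : ℕ, rangeSpace (S ^ n) = rangeSpace (S ^ (n + 1)) := by
  simp [descent, sInf_eq_top]

theorem nullSpace_eq_succ_of_ascent_eq {S : X →L[ℂ] X} {p : ℕ} (hp : ascent S = p) :
    nullSpace (S ^ p) = nullSpace (S ^ (p + 1)) := by
  obtain ⟨n, hn⟩ := ascent_ne_top_iff.1 (hp ▸ ENat.natCast_ne_top p)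
  obtain ⟨m, hm, hmp⟩ := csInf_mem (s := (fun n : ℕ => (n : ℕ∞)) ''
    {n : ℕ | nullSpace (S ^ n) = nullSpace (S ^ (n + 1))}) ⟨_, n, hn, rfl⟩
  obtain rfl : m = p := ENat.natCast_inj.1 (hmp.trans hp)
  exact hm

theorem ascent_eq_zero_of_injective {S : X →L[ℂ] X} (hS : Function.Injective S) :
    ascent S = 0 := by
  refine le_antisymm (sInf_le ⟨0, ?_, rfl⟩) bot_le
  ext x
  simp [mem_nullSpace, map_eq_zero_iff S hS]

end NullSpaces

/-! ### Operators bounded below and stability under small shifts -/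

section BoundedBelow

variable {X : Type*} [NormedAddCommGroup X] [NormedSpace ℂ X]

theorem IsBoundedBelow.injective {S : X →L[ℂ] X} (hS : IsBoundedBelow S) :
    Function.Injective S := by
  obtain ⟨c, hc, h⟩ := hS
  refine (injective_iff_map_eq_zero S).2 fun x hx => ?_
  have := h x
  rw [hx, norm_zero] at this
  exact norm_le_zero_iff.1 (nonpos_of_mul_nonpos_right this hc)

theorem IsBoundedBelow.exists_shift {S : X →L[ℂ] X} (hS : IsBoundedBelow S) :
    ∃ ε : ℝ, 0 < ε ∧ ∀ z : ℂ, ‖z‖ < ε → IsBoundedBelow (shift S z) := by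
  obtain ⟨c, hc, h⟩ := hS
  refine ⟨c, hc, fun z hz => ⟨c - ‖z‖, sub_pos.2 hz, fun x => ?_⟩⟩
  rw [shift_apply, sub_mul]
  have := norm_sub_norm_le (S x) (z • x)
  rw [norm_smul] at this
  linarith [h x]

theorem isBoundedBelow_of_injective_of_isClosed [CompleteSpace X] {S : X →L[ℂ] X}
    (hS : Function.Injective S) (hR : IsClosed (rangeSpace S : Set X)) : IsBoundedBelow S := by
  obtain ⟨K, hK⟩ := S.antilipschitz_of_injective_of_isClosed_range hS hR
  refine ⟨((K : ℝ) + 1)⁻¹, by positivity, fun x => ?_⟩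
  have := hK.le_mul_dist x 0
  rw [map_zero, dist_zero_right, dist_zero_right] at this
  rw [inv_mul_le_iff₀ (by positivity)]
  linarith [norm_nonneg (S x)]

theorem IsBoundedBelow.of_isUnit {S : X →L[ℂ] X} (hS : IsUnit S) : IsBoundedBelow S := by
  obtain ⟨u, rfl⟩ := hS
  refine ⟨(‖(↑u⁻¹ : X →L[ℂ] X)‖ + 1)⁻¹, by positivity, fun x => ?_⟩
  rw [inv_mul_le_iff₀ (by positivity)]
  have h : x = (↑u⁻¹ : X →L[ℂ] X) ((u : X →L[ℂ] X) x) := by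
    rw [← mul_apply_eq_comp, Units.inv_mul, one_apply_eq_self]
  have := (↑u⁻¹ : X →L[ℂ] X).le_opNorm ((u : X →L[ℂ] X) x)
  rw [← h] at this
  linarith [norm_nonneg ((u : X →L[ℂ] X) x)]

theorem isUnit_shift_of_isUnit [CompleteSpace X] {S : X →L[ℂ] X} (hS : IsUnit S) :
    ∃ ε : ℝ, 0 < ε ∧ ∀ z : ℂ, ‖z‖ < ε → IsUnit (shift S z) := by
  have hc : Continuous fun z : ℂ => shift S z := by unfold shift; fun_prop
  have h0 : shift S 0 = S := by simp [shift]
  have := hc.continuousAt.preimage_mem_nhds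
    (Units.isOpen.mem_nhds (show IsUnit (shift S 0) by rwa [h0]))
  obtain ⟨ε, hε, h⟩ := Metric.mem_nhds_iff.1 this
  exact ⟨ε, hε, fun z hz => h (by simpa using hz)⟩

end BoundedBelow

/-! ### Passing to the quotient by `N(S^p)` -/

section Quotient

variable {X : Type*} [NormedAddCommGroup X] [NormedSpace ℂ X]

/-- The operator induced by `S` on the quotient by an invariant subspace. -/
noncomputable def quotientMap (S : X →L[ℂ] X) (N : Submodule ℂ X) (hN : ∀ x ∈ N, S x ∈ N) :
    X ⧸ N →L[ℂ] X ⧸ N :=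
  N.liftQL (N.mkQL ∘L S) fun x hx => (Submodule.Quotient.mk_eq_zero N).2 (hN x hx)

theorem quotientMap_mk (S : X →L[ℂ] X) (N : Submodule ℂ X) (hN : ∀ x ∈ N, S x ∈ N) (x : X) :
    quotientMap S N hN (Submodule.Quotient.mk x) = Submodule.Quotient.mk (S x) := rfl

theorem shift_quotientMap_mk (S : X →L[ℂ] X) (N : Submodule ℂ X) (hN : ∀ x ∈ N, S x ∈ N)
    [IsClosed (N : Set X)] (z : ℂ) (x : X) :
    shift (quotientMap S N hN) z (Submodule.Quotient.mk x) =
      Submodule.Quotient.mk (shift S z x) := by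
  rw [shift_apply, shift_apply, Submodule.Quotient.mk_sub, Submodule.Quotient.mk_smul]
  rfl

/-- On the null space of `S ^ p` the operator `S - z` is inverted, up to the factor `-z ^ p`, by a
polynomial in `S`. -/
theorem exists_inverse_on_nullSpace_pow (S : X →L[ℂ] X) (p : ℕ) (z : ℂ) :
    ∃ G : X →L[ℂ] X, (∀ x ∈ nullSpace (S ^ p), G (shift S z x) = -(z ^ p • x)) ∧
      ∀ x ∈ nullSpace (S ^ p), shift S z (G x) = -(z ^ p • x) := by
  have hc : Commute S (algebraMap ℂ (X →L[ℂ] X) z) := (Algebra.commutes z S).symm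
  have key : ∀ x ∈ nullSpace (S ^ p), (S ^ p - algebraMap ℂ (X →L[ℂ] X) z ^ p) x = -(z ^ p • x) := by
    intro x hx
    rw [sub_apply, mem_nullSpace.1 hx, ← map_pow,
      Algebra.algebraMap_eq_smul_one]
    simp
  refine ⟨∑ i ∈ Finset.range p, S ^ i * algebraMap ℂ (X →L[ℂ] X) z ^ (p - 1 - i),
    fun x hx => ?_, fun x hx => ?_⟩
  · rw [← key x hx, ← hc.geom_sum₂_mul, shift_eq_sub_algebraMap, mul_apply_eq_comp]
  · rw [← key x hx, ← hc.mul_geom_sum₂, shift_eq_sub_algebraMap, mul_apply_eq_comp]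

theorem surjective_shift_of_quotientMap (S : X →L[ℂ] X) (p : ℕ) {z : ℂ} (hz : z ≠ 0)
    (h : ∀ y, ∃ x, y - shift S z x ∈ nullSpace (S ^ p)) : Function.Surjective (shift S z) := by
  obtain ⟨G, -, hG⟩ := exists_inverse_on_nullSpace_pow S p z
  intro y
  obtain ⟨x, hx⟩ := h y
  refine ⟨x - (z ^ p)⁻¹ • G (y - shift S z x), ?_⟩
  rw [map_sub, map_smul, hG _ hx, smul_neg, smul_smul, inv_mul_cancel₀ (pow_ne_zero p hz), one_smul]
  abel

/-- The class of `x` is controlled by hypothesis. Subtracting a nearly minimal representative `m`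
leaves a vector of `N(S^p)`, where the polynomial inverse `G` gives a lower bound. -/
theorem isBoundedBelow_shift_of_quotientMap (S : X →L[ℂ] X) (p : ℕ) {z : ℂ} (hz : z ≠ 0)
    {c : ℝ} (hc : 0 < c)
    (h : ∀ x, c * ‖(Submodule.Quotient.mk x : X ⧸ nullSpace (S ^ p))‖ ≤
      ‖(Submodule.Quotient.mk (shift S z x) : X ⧸ nullSpace (S ^ p))‖) :
    IsBoundedBelow (shift S z) := by
  obtain ⟨G, hG, -⟩ := exists_inverse_on_nullSpace_pow S p z
  set C : ℝ := ‖z ^ p‖⁻¹ * ‖G‖ with hC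
  have hC0 : 0 ≤ C := by positivity
  have hn : ∀ n ∈ nullSpace (S ^ p), ‖n‖ ≤ C * ‖shift S z n‖ := by
    intro n hn
    have := G.le_opNorm (shift S z n)
    rw [hG n hn, norm_neg, norm_smul] at this
    have hz' : 0 < ‖z ^ p‖ := norm_pos_iff.2 (pow_ne_zero p hz)
    rw [hC, mul_assoc, le_inv_mul_iff₀ hz']
    exact this
  set M : ℝ := ‖shift S z‖ with hM
  have hM0 : 0 ≤ M := norm_nonneg _
  set D : ℝ := C + (C * M + 1) / c with hD
  have bound : ∀ x, ‖x‖ ≤ D * ‖shift S z x‖ := by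
    intro x
    -- The quotient norm is an infimum that need not be attained, hence the slack `δ`, scaled to
    -- cancel the factor `C * M + 1`.
    refine le_of_forall_pos_le_add fun δ hδ => ?_
    have hδ' : 0 < δ / (C * M + 1) := by positivity
    obtain ⟨m, hm, hlt⟩ := Submodule.Quotient.norm_mk_lt
      (Submodule.Quotient.mk x : X ⧸ nullSpace (S ^ p)) hδ'
    have hxm : x - m ∈ nullSpace (S ^ p) := (Submodule.Quotient.eq _).1 hm.symm
    have h1 : ‖(Submodule.Quotient.mk x : X ⧸ nullSpace (S ^ p))‖ ≤ ‖shift S z x‖ / c := by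
      rw [le_div_iff₀' hc]
      exact (h x).trans (Submodule.Quotient.norm_mk_le _ _)
    have h2 : ‖m‖ ≤ ‖shift S z x‖ / c + δ / (C * M + 1) := by linarith
    have h3 : ‖shift S z (x - m)‖ ≤ ‖shift S z x‖ + M * ‖m‖ := by
      rw [map_sub]
      exact (norm_sub_le _ _).trans (by gcongr; exact (shift S z).le_opNorm m)
    have h4 : ‖x‖ ≤ ‖x - m‖ + ‖m‖ := by simpa using norm_add_le (x - m) m
    calc ‖x‖ ≤ C * (‖shift S z x‖ + M * ‖m‖) + ‖m‖ := by
          refine h4.trans (add_le_add_left ((hn _ hxm).trans ?_) _)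
          gcongr
      _ = C * ‖shift S z x‖ + (C * M + 1) * ‖m‖ := by ring
      _ ≤ C * ‖shift S z x‖ + (C * M + 1) * (‖shift S z x‖ / c + δ / (C * M + 1)) := by gcongr
      _ = D * ‖shift S z x‖ + δ := by rw [hD]; field_simp; ring
  have hD0 : 0 ≤ D := by positivity
  refine ⟨(D + 1)⁻¹, by positivity, fun x => ?_⟩
  rw [inv_mul_le_iff₀ (by positivity)]
  linarith [bound x, norm_nonneg (shift S z x)]

variable [CompleteSpace X]

theorem exists_isBoundedBelow_shift {S : X →L[ℂ] X} {p : ℕ}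
    (hp : nullSpace (S ^ p) = nullSpace (S ^ (p + 1)))
    (hR : IsClosed (rangeSpace (S ^ (p + 1)) : Set X)) :
    ∃ ε : ℝ, 0 < ε ∧ ∀ z : ℂ, z ≠ 0 → ‖z‖ < ε → IsBoundedBelow (shift S z) := by
  have hN : IsClosed (nullSpace (S ^ p) : Set X) := isClosed_nullSpace _
  set A := quotientMap S (nullSpace (S ^ p)) fun _ => map_mem_nullSpace_pow S p with hA
  have hinj : Function.Injective A := by
    refine (injective_iff_map_eq_zero A).2 fun x hx => ?_
    obtain ⟨x, rfl⟩ := Submodule.Quotient.mk_surjective _ x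
    rw [hA, quotientMap_mk, Submodule.Quotient.mk_eq_zero, mem_nullSpace, ← pow_succ_apply,
      ← mem_nullSpace, ← hp] at hx
    exact (Submodule.Quotient.mk_eq_zero _).2 hx
  have hcl : IsClosed (rangeSpace A : Set (X ⧸ nullSpace (S ^ p))) := by
    rw [← (nullSpace (S ^ p)).isQuotientMap_mkQL.isClosed_preimage]
    -- The range of `A` pulls back to `R(S) + N(S^p)`, which is the preimage of `R(S^(p+1))` under
    -- `S^p`.
    convert hR.preimage (S ^ p).continuous using 1
    ext x
    constructor
    · rintro ⟨y, hy⟩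
      obtain ⟨y, rfl⟩ := Submodule.Quotient.mk_surjective _ y
      have : S y - x ∈ nullSpace (S ^ p) := (Submodule.Quotient.eq _).1 hy
      rw [mem_nullSpace, map_sub, ← pow_succ_apply, sub_eq_zero] at this
      exact ⟨y, this⟩
    · rintro ⟨y, hy⟩
      refine ⟨Submodule.Quotient.mk y, (Submodule.Quotient.eq _).2 ?_⟩
      rw [mem_nullSpace, map_sub, sub_eq_zero]
      exact (pow_succ_apply S _ y).symm.trans hy
  obtain ⟨ε, hε, h⟩ := (isBoundedBelow_of_injective_of_isClosed hinj hcl).exists_shift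
  refine ⟨ε, hε, fun z hz hzε => ?_⟩
  obtain ⟨c, hc, hb⟩ := h z hzε
  refine isBoundedBelow_shift_of_quotientMap S p hz hc fun x => ?_
  rw [← shift_quotientMap_mk]
  exact hb _

/-- Surjectivity: `S^q x = S^(q+1) y` puts `x - S y` in `N(S^q)`, which lies in `N(S^p)` whatever
the order of `p` and `q`. -/
theorem isUnit_quotientMap {S : X →L[ℂ] X} {p q : ℕ}
    (hp : nullSpace (S ^ p) = nullSpace (S ^ (p + 1)))
    (hq : rangeSpace (S ^ q) = rangeSpace (S ^ (q + 1))) [IsClosed (nullSpace (S ^ p) : Set X)] :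
    IsUnit (quotientMap S (nullSpace (S ^ p)) fun _ => map_mem_nullSpace_pow S p) := by
  rw [ContinuousLinearMap.isUnit_iff_bijective]
  refine ⟨(injective_iff_map_eq_zero _).2 fun x hx => ?_, fun x => ?_⟩
  · obtain ⟨x, rfl⟩ := Submodule.Quotient.mk_surjective _ x
    rw [quotientMap_mk, Submodule.Quotient.mk_eq_zero, mem_nullSpace, ← pow_succ_apply,
      ← mem_nullSpace, ← hp] at hx
    exact (Submodule.Quotient.mk_eq_zero _).2 hx
  · obtain ⟨x, rfl⟩ := Submodule.Quotient.mk_surjective _ x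
    obtain ⟨y, hy⟩ : (S ^ q) x ∈ rangeSpace (S ^ (q + 1)) := hq ▸ ⟨x, rfl⟩
    refine ⟨Submodule.Quotient.mk y, (Submodule.Quotient.eq _).2 ?_⟩
    apply nullSpace_pow_le_of_eq_succ hp q
    rw [mem_nullSpace, map_sub, sub_eq_zero]
    exact (pow_succ_apply S _ y).symm.trans hy

theorem exists_isUnit_shift {S : X →L[ℂ] X} (ha : ascent S ≠ ⊤) (hd : descent S ≠ ⊤) :
    ∃ ε : ℝ, 0 < ε ∧ ∀ z : ℂ, z ≠ 0 → ‖z‖ < ε → IsUnit (shift S z) := by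
  obtain ⟨p, hp⟩ := ascent_ne_top_iff.1 ha
  obtain ⟨q, hq⟩ := descent_ne_top_iff.1 hd
  have hN : IsClosed (nullSpace (S ^ p) : Set X) := isClosed_nullSpace _
  obtain ⟨ε, hε, h⟩ := isUnit_shift_of_isUnit (isUnit_quotientMap hp hq)
  refine ⟨ε, hε, fun z hz hzε => ?_⟩
  have hu := h z hzε
  obtain ⟨c, hc, hb⟩ := IsBoundedBelow.of_isUnit hu
  rw [ContinuousLinearMap.isUnit_iff_bijective] at hu ⊢
  refine ⟨(isBoundedBelow_shift_of_quotientMap S p hz hc fun x => ?_).injective,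
    surjective_shift_of_quotientMap S p hz fun y => ?_⟩
  · rw [← shift_quotientMap_mk]
    exact hb _
  · obtain ⟨x, hx⟩ := hu.2 (Submodule.Quotient.mk y)
    obtain ⟨x, rfl⟩ := Submodule.Quotient.mk_surjective _ x
    rw [shift_quotientMap_mk] at hx
    exact ⟨x, (Submodule.Quotient.eq _).1 hx.symm⟩

theorem isUnit_of_injective_of_descent_ne_top {S : X →L[ℂ] X} (hS : Function.Injective S)
    (hd : descent S ≠ ⊤) : IsUnit S := by
  obtain ⟨q, hq⟩ := descent_ne_top_iff.1 hd
  have hSq : Function.Injective (S ^ q) := by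
    rw [FunLike.coe_pow_eq_iterate]
    exact hS.iterate q
  refine ContinuousLinearMap.isUnit_iff_bijective.2 ⟨hS, fun x => ?_⟩
  obtain ⟨y, hy⟩ : (S ^ q) x ∈ rangeSpace (S ^ (q + 1)) := hq ▸ ⟨x, rfl⟩
  exact ⟨y, hSq ((pow_succ_apply S q y).symm.trans hy)⟩

end Quotient

/-! ### Fredholm and Weyl operators: closed ranges, finite ascent and descent -/

section Fredholm

variable {X : Type*} [NormedAddCommGroup X] [NormedSpace ℂ X]

theorem nullSpace_one : nullSpace (1 : X →L[ℂ] X) = ⊥ := by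
  ext x
  simp [mem_nullSpace]

theorem rangeSpace_one : rangeSpace (1 : X →L[ℂ] X) = ⊤ := by
  ext x
  simp [mem_rangeSpace]

theorem finiteDimensional_nullSpace_pow {S : X →L[ℂ] X} (hS : FiniteDimensional ℂ (nullSpace S))
    (n : ℕ) : FiniteDimensional ℂ (nullSpace (S ^ n)) := by
  induction n with
  | zero => rw [pow_zero, nullSpace_one]; infer_instance
  | succ n ih =>
    rw [← Submodule.fg_iff_finiteDimensional]
    refine Submodule.fg_of_fg_map_of_fg_inf_ker (S : X →ₗ[ℂ] X) ?_ ?_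
    · rw [Submodule.fg_iff_finiteDimensional]
      refine Submodule.finiteDimensional_of_le (S₂ := nullSpace (S ^ n)) ?_
      rintro _ ⟨x, hx, rfl⟩
      rw [mem_nullSpace]
      exact (pow_succ_apply S n x).symm.trans hx
    · rw [Submodule.fg_iff_finiteDimensional]
      exact Submodule.finiteDimensional_of_le (S₂ := nullSpace S) inf_le_right

theorem finiteDimensional_quotient_rangeSpace_pow {S : X →L[ℂ] X}
    (hS : FiniteDimensional ℂ (X ⧸ rangeSpace S)) (n : ℕ) :
    FiniteDimensional ℂ (X ⧸ rangeSpace (S ^ n)) := by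
  induction n with
  | zero => rw [pow_zero, rangeSpace_one]; infer_instance
  | succ n ih =>
    obtain ⟨V, hV⟩ := (rangeSpace S).exists_isCompl
    obtain ⟨W, hW⟩ := (rangeSpace (S ^ n)).exists_isCompl
    have hVf : V.FG := Submodule.CoFG.fg_of_isCompl hV hS
    have hWf : W.FG := Submodule.CoFG.fg_of_isCompl hW ih
    -- If `X = R(S) + V = R(S^n) + W`, then `X = R(S^(n+1)) + S^n V + W`.
    refine Submodule.FG.cofg_of_codisjoint (S := V.map ((S ^ n : X →L[ℂ] X) : X →ₗ[ℂ] X) ⊔ W) ?_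
      ((hVf.map _).sup hWf)
    rw [codisjoint_iff, eq_top_iff]
    intro x _
    obtain ⟨_, ⟨y, rfl⟩, w, hw, rfl⟩ :=
      Submodule.mem_sup.1 (hW.sup_eq_top ▸ Submodule.mem_top : x ∈ rangeSpace (S ^ n) ⊔ W)
    obtain ⟨_, ⟨u, rfl⟩, v, hv, rfl⟩ :=
      Submodule.mem_sup.1 (hV.sup_eq_top ▸ Submodule.mem_top : y ∈ rangeSpace S ⊔ V)
    refine Submodule.mem_sup.2 ⟨_, Submodule.add_mem_sup (Submodule.mem_map_of_mem hv) hw,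
      (S ^ (n + 1)) u, ⟨u, rfl⟩, ?_⟩
    simp only [ContinuousLinearMap.coe_coe, map_add, pow_succ_apply]
    abel

/-- A dimension count on `P = N(S^p)`: the map `g : P → X/R(S)` has kernel `S(P)`, so its rank is
`dim ker(S|P) = dim N(S)`. Index zero makes this `codim R(S)`, so `g` is onto. -/
theorem rangeSpace_sup_nullSpace_pow {S : X →L[ℂ] X} (hS : IsWeyl S) {p : ℕ}
    (hp : nullSpace (S ^ p) = nullSpace (S ^ (p + 1))) :
    rangeSpace S ⊔ nullSpace (S ^ p) = ⊤ := by
  have hfin := hS.1.1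
  have hcofin := hS.1.2
  have hP := finiteDimensional_nullSpace_pow hfin p
  set P := nullSpace (S ^ p)
  have hSP : ∀ x ∈ P, (S : X →ₗ[ℂ] X) x ∈ P := fun x => map_mem_nullSpace_pow S p
  let f : P →ₗ[ℂ] P := (S : X →ₗ[ℂ] X).restrict hSP
  let g : P →ₗ[ℂ] X ⧸ rangeSpace S := (rangeSpace S).mkQ ∘ₗ P.subtype
  have hker : LinearMap.ker g = LinearMap.range f := by
    ext ⟨x, hx⟩
    constructor
    · intro h
      obtain ⟨y, rfl⟩ : x ∈ rangeSpace S := (Submodule.Quotient.mk_eq_zero _).1 h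
      refine ⟨⟨y, ?_⟩, rfl⟩
      rw [hp, mem_nullSpace, pow_succ_apply]
      exact hx
    · rintro ⟨y, hy⟩
      exact (Submodule.Quotient.mk_eq_zero _).2 ⟨y, congrArg Subtype.val hy⟩
  have hkerf : Module.finrank ℂ (LinearMap.ker f) = Module.finrank ℂ (nullSpace S) := by
    have hmap : (LinearMap.ker f).map P.subtype = nullSpace S := by
      ext x
      constructor
      · rintro ⟨y, hy, rfl⟩
        exact congrArg Subtype.val hy
      · intro hx
        have hxP : x ∈ P := nullSpace_pow_le_of_eq_succ hp 1 (by rwa [pow_one])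
        exact ⟨⟨x, hxP⟩, Subtype.ext hx, rfl⟩
    rw [← hmap]
    exact (P.equivSubtypeMap (LinearMap.ker f)).finrank_eq
  have h1 := f.finrank_range_add_finrank_ker
  have h2 := g.finrank_range_add_finrank_ker
  have h3 := hS.2
  unfold index at h3
  rw [hker] at h2
  have hg : LinearMap.range g = ⊤ := Submodule.eq_top_of_finrank_eq (by omega)
  rw [eq_top_iff]
  intro x _
  obtain ⟨y, hy⟩ : (Submodule.Quotient.mk x : X ⧸ rangeSpace S) ∈ LinearMap.range g :=
    hg ▸ Submodule.mem_top
  have : x - y ∈ rangeSpace S := (Submodule.Quotient.eq _).1 hy.symm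
  simpa using Submodule.add_mem_sup this y.2

theorem descent_ne_top_of_isWeyl {S : X →L[ℂ] X} (hS : IsWeyl S) (ha : ascent S ≠ ⊤) :
    descent S ≠ ⊤ := by
  obtain ⟨p, hp⟩ := ascent_ne_top_iff.1 ha
  refine descent_ne_top_iff.2 ⟨p, le_antisymm ?_ (rangeSpace_pow_anti S p.le_succ)⟩
  rintro _ ⟨x, rfl⟩
  obtain ⟨_, ⟨y, rfl⟩, w, hw, rfl⟩ := Submodule.mem_sup.1
    (rangeSpace_sup_nullSpace_pow hS hp ▸ Submodule.mem_top : x ∈ rangeSpace S ⊔ nullSpace (S ^ p))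
  refine ⟨y, ?_⟩
  change (S ^ (p + 1)) y = (S ^ p) (S y + w)
  rw [map_add, mem_nullSpace.1 hw, add_zero, pow_succ_apply]

variable [CompleteSpace X]

theorem isClosed_rangeSpace_of_finiteDimensional_quotient {S : X →L[ℂ] X}
    (hS : FiniteDimensional ℂ (X ⧸ rangeSpace S)) : IsClosed (rangeSpace S : Set X) := by
  have hN : IsClosed (nullSpace S : Set X) := isClosed_nullSpace _
  let A : X ⧸ nullSpace S →L[ℂ] X := (nullSpace S).liftQL S le_rfl
  have hrange : A.range = rangeSpace S := Submodule.range_liftQ _ _ _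
  have hker : A.ker = ⊥ := Submodule.ker_liftQ_eq_bot _ _ _ le_rfl
  obtain ⟨V, hV⟩ := (rangeSpace S).exists_isCompl
  have : FiniteDimensional ℂ V :=
    Submodule.fg_iff_finiteDimensional _ |>.1 (Submodule.CoFG.fg_of_isCompl hV hS)
  rw [← hrange] at hV ⊢
  exact A.closed_complemented_range_of_isCompl_of_ker_eq_bot V hV V.closed_of_finiteDimensional hker

theorem isClosed_rangeSpace_pow {S : X →L[ℂ] X} (hS : IsFredholm S) (n : ℕ) :
    IsClosed (rangeSpace (S ^ n) : Set X) :=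
  isClosed_rangeSpace_of_finiteDimensional_quotient
    (finiteDimensional_quotient_rangeSpace_pow hS.2 n)

/-- `S` is bijective from a closed complement of its kernel onto `X`, so the open mapping theorem
gives a bounded inverse. -/
theorem exists_rightInverse_of_surjective {S : X →L[ℂ] X} (hS : Function.Surjective S)
    (hfin : FiniteDimensional ℂ (nullSpace S)) : ∃ R : X →L[ℂ] X, ∀ x, S (R x) = x := by
  obtain ⟨W, hW, hc⟩ := (Submodule.ClosedComplemented.of_finiteDimensional
    (𝕜 := ℂ) (nullSpace S)).exists_isClosed_isCompl
  have : CompleteSpace W := hW.completeSpace_coe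
  let A : W →L[ℂ] X := S ∘L W.subtypeL
  have hker : A.ker = ⊥ := by
    refine (Submodule.eq_bot_iff _).2 fun x hx => Subtype.ext ?_
    exact (Submodule.disjoint_def.1 hc.disjoint) x hx x.2
  have hrange : A.range = ⊤ := by
    refine LinearMap.range_eq_top.2 fun y => ?_
    obtain ⟨x, rfl⟩ := hS y
    obtain ⟨n, hn, w, hw, rfl⟩ := Submodule.mem_sup.1
      (hc.sup_eq_top ▸ Submodule.mem_top : x ∈ nullSpace S ⊔ W)
    refine ⟨⟨w, hw⟩, ?_⟩
    simp [A, mem_nullSpace.1 hn]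
  let e := ContinuousLinearEquiv.ofBijective A hker hrange
  exact ⟨W.subtypeL ∘L (e.symm : X →L[ℂ] W), fun x => e.apply_symm_apply x⟩

/-- A surjective operator with finite-dimensional nonzero null space remains non-injective under
small perturbations by scalars. -/
theorem exists_not_injective_shift_of_surjective {S : X →L[ℂ] X} (hS : Function.Surjective S)
    (hfin : FiniteDimensional ℂ (nullSpace S)) {x₀ : X} (hx₀ : S x₀ = 0) (hne : x₀ ≠ 0) :
    ∃ ε : ℝ, 0 < ε ∧ ∀ z : ℂ, ‖z‖ < ε → ∃ x, x ≠ 0 ∧ shift S z x = 0 := by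
  obtain ⟨R, hR⟩ := exists_rightInverse_of_surjective hS hfin
  refine ⟨(‖R‖ + 1)⁻¹, by positivity, fun z hz => ?_⟩
  have hlt : ‖z • R‖ < 1 := by
    rw [norm_smul]
    calc ‖z‖ * ‖R‖ ≤ (‖R‖ + 1)⁻¹ * ‖R‖ := by gcongr
      _ < 1 := by rw [inv_mul_lt_iff₀ (by positivity)]; linarith
  -- Solving `x - zRx = x₀` and applying `S` gives `Sx - zx = Sx₀ = 0`.
  let u := Units.oneSub (z • R) hlt
  have hu : (u : X →L[ℂ] X) ((↑u⁻¹ : X →L[ℂ] X) x₀) = x₀ := by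
    rw [← mul_apply_eq_comp, Units.mul_inv, one_apply_eq_self]
  set x := (↑u⁻¹ : X →L[ℂ] X) x₀ with hx
  refine ⟨x, fun h0 => hne ?_, ?_⟩
  · rw [← hu, h0, map_zero]
  · have h1 : x - z • R x = x₀ := hu
    rw [shift_apply, ← hx₀, ← h1, map_sub, map_smul, hR]

/-- On the closed hyperrange `M = ⋂ R(S^n)` the operator is onto. Infinite ascent would give it a
nonzero kernel there, which survives small shifts and contradicts injectivity. -/
theorem ascent_ne_top_of_isFredholm {S : X →L[ℂ] X} (hS : IsFredholm S) {ε : ℝ} (hε : 0 < ε)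
    (hinj : ∀ z : ℂ, z ≠ 0 → ‖z‖ < ε → Function.Injective (shift S z)) : ascent S ≠ ⊤ := by
  intro htop
  have hfin := hS.1
  have hasc : ∀ n, nullSpace (S ^ n) ≠ nullSpace (S ^ (n + 1)) := by
    intro n hn
    exact ascent_ne_top_iff.2 ⟨n, hn⟩ htop
  -- The decreasing subspaces `N(S) ∩ R(S^n)` of the finite-dimensional `N(S)` are constant from `d`
  -- on.
  obtain ⟨d, hd⟩ := IsArtinian.monotone_stabilizes (R := ℂ) (M := nullSpace S)
    ⟨fun n => OrderDual.toDual ((rangeSpace (S ^ n)).comap (nullSpace S).subtype),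
      fun m n hmn => Submodule.comap_mono (rangeSpace_pow_anti S hmn)⟩
  have hstab : ∀ x ∈ nullSpace S, x ∈ rangeSpace (S ^ d) → ∀ n, x ∈ rangeSpace (S ^ n) := by
    intro x hx hxd n
    rcases le_total n d with h | h
    · exact rangeSpace_pow_anti S h hxd
    · have : (⟨x, hx⟩ : nullSpace S) ∈ (rangeSpace (S ^ d)).comap (nullSpace S).subtype := hxd
      have hd' : (rangeSpace (S ^ d)).comap (nullSpace S).subtype =
        (rangeSpace (S ^ n)).comap (nullSpace S).subtype := hd n h
      rw [hd'] at this
      exact this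
  set M : Submodule ℂ X := ⨅ n, rangeSpace (S ^ n) with hM
  have hMcl : IsClosed (M : Set X) := by
    rw [hM, Submodule.coe_iInf]
    exact isClosed_iInter fun n => isClosed_rangeSpace_pow hS n
  have : CompleteSpace M := hMcl.completeSpace_coe
  have hmem : ∀ {x}, x ∈ M ↔ ∀ n, x ∈ rangeSpace (S ^ n) := Submodule.mem_iInf _
  have hSM : ∀ x ∈ M, S x ∈ M := by
    intro x hx
    refine hmem.2 fun n => ?_
    obtain ⟨y, rfl⟩ := hmem.1 hx n
    exact ⟨S y, pow_apply_comm S n y⟩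
  let A : M →L[ℂ] M := S.restrict hSM
  have hAv : ∀ x : M, (A x : X) = S x := fun x => rfl
  have hsurj : Function.Surjective A := by
    rintro ⟨y, hy⟩
    obtain ⟨w, hw⟩ := hmem.1 hy (d + 1)
    rw [ContinuousLinearMap.coe_coe, pow_succ_apply, pow_apply_comm] at hw
    refine ⟨⟨(S ^ d) w, hmem.2 fun n => ?_⟩, Subtype.ext hw⟩
    -- A second preimage of `y`, lying in both `R(S^n)` and `R(S^d)`; it differs from `S^d w` by an
    -- element of `N(S) ∩ R(S^d)`, hence of `R(S^n)`.
    obtain ⟨v, hv⟩ := hmem.1 hy (max n d + 1)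
    rw [ContinuousLinearMap.coe_coe, pow_succ_apply, pow_apply_comm] at hv
    have hvd : (S ^ max n d) v ∈ rangeSpace (S ^ d) :=
      rangeSpace_pow_anti S (le_max_right n d) ⟨v, rfl⟩
    have hvn : (S ^ max n d) v ∈ rangeSpace (S ^ n) :=
      rangeSpace_pow_anti S (le_max_left n d) ⟨v, rfl⟩
    have hdiff := hstab ((S ^ d) w - (S ^ max n d) v)
      (by rw [mem_nullSpace, map_sub, hw, hv, sub_self])
      (Submodule.sub_mem _ ⟨w, rfl⟩ hvd) n
    simpa using Submodule.add_mem _ hdiff hvn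
  have hAfin : FiniteDimensional ℂ (nullSpace A) := by
    let i : nullSpace A →ₗ[ℂ] nullSpace S :=
      (M.subtype ∘ₗ (nullSpace A).subtype).codRestrict (nullSpace S)
        fun x => congrArg Subtype.val x.2
    refine FiniteDimensional.of_injective i fun x y hxy => ?_
    exact Subtype.ext (Subtype.ext (congrArg (fun v : nullSpace S => (v : X)) hxy))
  -- As `N(S^d) ≠ N(S^(d+1))`, some `S^d x` is a nonzero element of `N(S) ∩ R(S^d)`, hence of `M`.
  obtain ⟨x, hx, hx'⟩ := Set.exists_of_ssubset
    ((nullSpace_pow_mono S d.le_succ).lt_of_ne (hasc d))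
  have hSx : S ((S ^ d) x) = 0 := by
    rw [← pow_apply_comm, ← pow_succ_apply]
    exact hx
  let x₀ : M := ⟨(S ^ d) x, hmem.2 (hstab _ hSx ⟨x, rfl⟩)⟩
  obtain ⟨η, hη, h⟩ := exists_not_injective_shift_of_surjective hsurj hAfin (x₀ := x₀)
    (Subtype.ext hSx) fun h0 => hx' (congrArg Subtype.val h0)
  obtain ⟨r, hr0, hr⟩ := exists_between (lt_min hε hη)
  have hrn : ‖(r : ℂ)‖ = r := by rw [Complex.norm_real, Real.norm_of_nonneg hr0.le]
  obtain ⟨y, hy, hAy⟩ := h (r : ℂ) (by rw [hrn]; exact hr.trans_le (min_le_right _ _))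
  refine hy (Subtype.ext (hinj (r : ℂ) (by exact_mod_cast hr0.ne')
    (by rw [hrn]; exact hr.trans_le (min_le_left _ _)) ?_))
  rw [shift_apply] at hAy
  have := congrArg Subtype.val hAy
  rw [shift_apply]
  simpa [hAv, shift_apply] using this

end Fredholm

/-! ### Isolated spectral points, poles and left poles -/

section Isolated

variable {X : Type*} [NormedAddCommGroup X] [NormedSpace ℂ X]

theorem mem_iso_iff {A : Set ℂ} {a : ℂ} :
    a ∈ iso A ↔ a ∈ A ∧ ∃ ε : ℝ, 0 < ε ∧ ∀ z : ℂ, z ≠ 0 → ‖z‖ < ε → a + z ∉ A := by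
  unfold iso
  rw [Set.mem_ofPred_eq, accPt_iff_frequently, Filter.not_frequently, Metric.eventually_nhds_iff]
  refine and_congr_right fun _ => exists_congr fun ε => and_congr_right fun _ =>
    ⟨fun h z hz hzε hmem => ?_, fun h y hy hyA => ?_⟩
  · exact h (y := a + z) (by simpa [dist_eq_norm] using hzε) ⟨by simpa using hz, hmem⟩
  · refine h (y - a) (sub_ne_zero.2 hyA.1) (by simpa [dist_eq_norm] using hy) ?_
    simpa using hyA.2

theorem mem_eigenvalues_iff {T : X →L[ℂ] X} {a : ℂ} :
    a ∈ eigenvalues T ↔ ¬ Function.Injective (shift T a) := by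
  have h : (shift T a : X →ₗ[ℂ] X) = (T : X →ₗ[ℂ] X) - a • 1 := by
    ext x
    simp [shift_apply]
  rw [eigenvalues, Set.mem_ofPred_eq, Module.End.hasEigenvalue_iff, Module.End.eigenspace_def, ← h,
    Ne, LinearMap.ker_eq_bot]
  rfl

theorem mem_spectrum_iff {T : X →L[ℂ] X} {a : ℂ} :
    a ∈ spectrum ℂ T ↔ ¬ IsUnit (shift T a) := by
  rw [spectrum.mem_iff, shift_eq_sub_algebraMap, IsUnit.sub_iff]

theorem approxPointSpectrum_subset_spectrum (T : X →L[ℂ] X) :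
    approxPointSpectrum T ⊆ spectrum ℂ T := fun _ ha =>
  mem_spectrum_iff.2 fun hu => ha (IsBoundedBelow.of_isUnit hu)

theorem eigenvalues_subset_approxPointSpectrum (T : X →L[ℂ] X) :
    eigenvalues T ⊆ approxPointSpectrum T := fun _ ha hb => mem_eigenvalues_iff.1 ha hb.injective

theorem E_subset_Ea (T : X →L[ℂ] X) : E T ⊆ Ea T := by
  rintro a ⟨hi, he⟩
  obtain ⟨-, ε, hε, h⟩ := mem_iso_iff.1 hi
  exact ⟨mem_iso_iff.2 ⟨eigenvalues_subset_approxPointSpectrum T he, ε, hε, fun z hz hzε hmem =>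
    h z hz hzε (approxPointSpectrum_subset_spectrum T hmem)⟩, he⟩

variable [CompleteSpace X]

theorem poles_subset_E (T : X →L[ℂ] X) : poles T ⊆ E T := by
  rintro a ⟨hs, ha, hd⟩
  obtain ⟨ε, hε, h⟩ := exists_isUnit_shift ha hd
  refine ⟨mem_iso_iff.2 ⟨hs, ε, hε, fun z hz hzε hmem => ?_⟩, mem_eigenvalues_iff.2 fun hinj => ?_⟩
  · refine mem_spectrum_iff.1 hmem ?_
    rw [← shift_shift]
    exact h z hz hzε
  · exact mem_spectrum_iff.1 hs (isUnit_of_injective_of_descent_ne_top hinj hd)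

theorem leftPoles_subset_Ea (T : X →L[ℂ] X) : leftPoles T ⊆ Ea T := by
  rintro a ⟨hs, p, hp, hR⟩
  obtain ⟨ε, hε, h⟩ := exists_isBoundedBelow_shift (nullSpace_eq_succ_of_ascent_eq hp) hR
  refine ⟨mem_iso_iff.2 ⟨hs, ε, hε, fun z hz hzε hmem => hmem ?_⟩,
    mem_eigenvalues_iff.2 fun hinj => hs ?_⟩
  · rw [← shift_shift]
    exact h z hz hzε
  · obtain rfl : p = 0 := ENat.natCast_inj.1 (hp.symm.trans (ascent_eq_zero_of_injective hinj))
    rw [zero_add, pow_one] at hR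
    exact isBoundedBelow_of_injective_of_isClosed hinj hR

theorem ascent_shift_ne_top_of_mem_iso {T : X →L[ℂ] X} {a : ℂ}
    (hF : IsFredholm (shift T a)) (ha : a ∈ iso (approxPointSpectrum T)) :
    ascent (shift T a) ≠ ⊤ := by
  obtain ⟨-, ε, hε, h⟩ := mem_iso_iff.1 ha
  refine ascent_ne_top_of_isFredholm hF hε fun z hz hzε => ?_
  rw [shift_shift]
  exact (not_not.1 (h z hz hzε) : IsBoundedBelow _).injective

end Isolated

end WeylType

open WeylType

theorem mainTheorem8 {X : Type*} [NormedAddCommGroup X] [NormedSpace ℂ X] [CompleteSpace X]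
    (hX : ¬ FiniteDimensional ℂ X) (T : X →L[ℂ] X) (hT : WeylType.PropertyZEa T) :
    WeylType.Ea T = WeylType.Ea0 T ∧
    WeylType.Ea0 T = WeylType.leftPoles0 T ∧
    WeylType.leftPoles0 T = WeylType.leftPoles T ∧
    WeylType.leftPoles T = WeylType.poles0 T ∧
    WeylType.poles0 T = WeylType.poles T ∧
    WeylType.poles T = WeylType.E0 T ∧
    WeylType.E0 T = WeylType.E T := by
  have weyl : ∀ a ∈ Ea T, a ∈ spectrum ℂ T ∧ IsWeyl (shift T a) := by
    intro a ha
    rw [← show spectrum ℂ T \ weylSpectrum T = Ea T from hT] at ha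
    exact ⟨ha.1, not_not.1 ha.2⟩
  have asc : ∀ a ∈ Ea T, ascent (shift T a) ≠ ⊤ := fun a ha =>
    ascent_shift_ne_top_of_mem_iso (weyl a ha).2.1 ha.1
  have hEa0 : Ea0 T = Ea T := Set.Subset.antisymm (fun a ha => ⟨ha.1, ha.2.1⟩)
    fun a ha => ⟨ha.1, ha.2, (weyl a ha).2.1.1⟩
  have h1 : Ea T ⊆ poles0 T := fun a ha =>
    ⟨⟨(weyl a ha).1, asc a ha, descent_ne_top_of_isWeyl (weyl a ha).2 (asc a ha)⟩,
      (weyl a ha).2.1.1⟩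
  have h2 : Ea T ⊆ leftPoles0 T := fun a ha => by
    obtain ⟨p, hp⟩ := ENat.ne_top_iff_exists.1 (asc a ha)
    exact ⟨⟨ha.1.1, p, hp.symm, isClosed_rangeSpace_pow (weyl a ha).2.1 _⟩, (weyl a ha).2.1.1⟩
  have hpoles0 : poles0 T ⊆ poles T := fun a ha => ha.1
  have hleft0 : leftPoles0 T ⊆ leftPoles T := fun a ha => ha.1
  have hE0 : E0 T ⊆ E T := fun a ha => ⟨ha.1, ha.2.1⟩
  have hpoles : poles T ⊆ Ea T := (poles_subset_E T).trans (E_subset_Ea T)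
  have h3 : Ea T ⊆ E0 T := fun a ha =>
    have h := poles_subset_E T (h1 ha).1
    ⟨h.1, h.2, (weyl a ha).2.1.1⟩
  have e1 : leftPoles0 T = Ea T := (hleft0.trans (leftPoles_subset_Ea T)).antisymm h2
  have e2 : leftPoles T = Ea T := (leftPoles_subset_Ea T).antisymm (h2.trans hleft0)
  have e3 : poles0 T = Ea T := (hpoles0.trans hpoles).antisymm h1
  have e4 : poles T = Ea T := hpoles.antisymm (h1.trans hpoles0)
  have e5 : E0 T = Ea T := (hE0.trans (E_subset_Ea T)).antisymm h3
  have e6 : E T = Ea T := (E_subset_Ea T).antisymm (h3.trans hE0)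
  rw [hEa0, e1, e2, e3, e4, e5, e6]
  exact ⟨rfl, rfl, rfl, rfl, rfl, rfl, rfl⟩
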